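/- A Lie $p$-ring is a finite Lie ring whose additive group is a $p$-group. For a Lie ring $M$ put $\gamma_1(M)=M$ and $\gamma_{i+1}(M)=[\gamma_i(M),M]$, and for a natural number $n$ let $nL=\{nx : x\in L\}$, regarded as a Lie ring in its own right. There exist functions $g:\mathbb N\to\mathbb N_{\ge 1}$ and $f:\mathbb N^4\to\mathbb N$ with the following property. Let $p$ be a prime, let $t\ge 1$ and $s,r\ge 0$ be integers, and let $L$ be a Lie $p$-ring that is metabelian, i.e. soluble of derived length at most $2$: $[[L,L],[L,L]]=0$. Suppose that $L$ admits a Lie ring automorphism $\varphi$ of order $p^t$ (exactly) with exactly $p^s$ fixed points in $L$, such that $\varphi^{p^{t-1}}$ has exactly $p^r$ fixed points in $L$. Then $$\gamma_{g(s)}\bigl(p^{f(p,t,s,r)}L\bigr)=0 .$$ -/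

import Mathlib

/-- A (finite) Lie `p`-ring: a finite Lie ring whose additive group is a `p`-group. -/
structure IsLiePRing (p : ℕ) (L : Type*) [LieRing L] : Prop where
  finite : Finite L
  isPGroup : IsPGroup p (Multiplicative L)

/-- The ideal `n L = {n x | x ∈ L}` of a Lie ring `L`. -/
def mulIdeal (n : ℕ) (L : Type*) [LieRing L] : LieIdeal ℤ L where
  carrier := {y | ∃ x : L, n • x = y}
  add_mem' := by
    rintro _ _ ⟨x, rfl⟩ ⟨y, rfl⟩
    exact ⟨x + y, smul_add n x y⟩
  zero_mem' := ⟨0, smul_zero n⟩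
  smul_mem' := by
    rintro c _ ⟨x, rfl⟩
    exact ⟨c • x, smul_comm n c x⟩
  lie_mem := by
    rintro x _ ⟨y, rfl⟩
    exact ⟨⁅x, y⁆, (lie_nsmul x y n).symm⟩

/-- The lower central series `γ_1(M) = M`, `γ_{i+1}(M) = [M, γ_i(M)]` of a Lie ring `M`, indexed
from `1` (Mathlib's indexing starts at `0`); the index `0` is not meant to be used. -/
def lieGamma (i : ℕ) (M : Type*) [LieRing M] : LieIdeal ℤ M :=
  LieModule.lowerCentralSeries ℤ M M (i - 1)

/-- A Lie ring automorphism as an element of the automorphism group of the additive group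
(Mathlib has no group structure on `L ≃ₗ⁅ℤ⁆ L`). Orders and powers of Lie ring automorphisms are
computed in this larger group. -/
def lieAutToAddAut {L : Type*} [LieRing L] (φ : L ≃ₗ⁅ℤ⁆ L) : L ≃ₗ[ℤ] L :=
  φ.toLinearEquiv

/-- The number of fixed points of an additive automorphism. -/
noncomputable def numFixedPoints {L : Type*} [AddCommGroup L] (σ : L ≃ₗ[ℤ] L) : ℕ :=
  Nat.card {x : L // σ x = x}

/-! Put t = u + 1 and let ζ be a primitive p^t-th root of unity. On p^r L the trace 1 + σ + … +
σ^(p-1) of σ = φ^(p^u) vanishes, so p^r L is a finite p-module over ℤ[ζ] with ζ acting as φ. There p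
is a unit times a power of ζ - 1, and the fixed points are the kernel of ζ - 1. As L is metabelian,
V = p^r L acts by commuting operators on the centralizer of [L, L] in p^r L, and commutators become
powers of this action. It remains to bound, for such an action on M with at most p^d fixed points, a
power V^g M that is killed by a bounded power of p, with g depending on d only.

Two facts start the argument: p^(p-1) V^(p-1) M = 0, by elimination from the trace relation
(`pow_smul_power_eq_zero`), and divisibility of fixed points forces divisibility of torsion
(`mem_of_fixedIn_le`). Together they give `pow_smul_power_eq_zero_of_card`, where the number of
factors is d instead of p - 1.

If the torsion of M up to exponent p^a behaves as in a free ℤ/p^a-module, the action can be divided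
by p^k on a suitable submodule. Applying the previous estimate to the divided action improves k to k
+ 1 (`power_succ_le_stair_succ`), and iteration puts V^((d+1)(d+2)) M into p^a M up to a bounded
power of p (`pow_smul_mem_of_flat`). With a maximal such that p^a M contains all fixed points,
p^(a+1) M has fewer of them, and induction on d finishes. -/

section

open Polynomial

/-! ### Finite p-modules over a cyclotomic ring and their fixed points -/

/-- The submodule given by an additive subgroup that is stable under the variable. -/
noncomputable def submoduleOfXStable {M : Type*} [AddCommGroup M] [Module ℤ[X] M] (A : AddSubgroup M)
    (h : ∀ x ∈ A, (X : ℤ[X]) • x ∈ A) : Submodule ℤ[X] M where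
  carrier := A
  add_mem' := A.add_mem
  zero_mem' := A.zero_mem
  smul_mem' := by
    intro c x hx
    change c • x ∈ A
    induction c using Polynomial.induction_on with
    | C a =>
      have : (C a : ℤ[X]) • x = a • x := by
        rw [← Int.cast_smul_eq_zsmul ℤ[X] a x]; simp
      rw [this]
      exact A.zsmul_mem hx a
    | add f g hf hg => rw [add_smul]; exact A.add_mem hf hg
    | monomial n a ih =>
      rw [pow_succ, ← mul_assoc, mul_comm, mul_smul]
      exact h _ ih

/-- The submodule `n A` of multiples by a natural number `n`. -/
noncomputable def natMul {R M : Type*} [CommRing R] [AddCommGroup M] [Module R M] (n : ℕ)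
    (A : Submodule R M) : Submodule R M := A.map (LinearMap.lsmul R M (n : R))

lemma mem_natMul {R M : Type*} [CommRing R] [AddCommGroup M] [Module R M] {n : ℕ}
    {A : Submodule R M} {x : M} : x ∈ natMul n A ↔ ∃ y ∈ A, n • y = x := by
  simp [natMul, Nat.cast_smul_eq_nsmul]

lemma nsmul_mem_natMul {R M : Type*} [CommRing R] [AddCommGroup M] [Module R M] (n : ℕ)
    {A : Submodule R M} {x : M} (hx : x ∈ A) : n • x ∈ natMul n A :=
  mem_natMul.2 ⟨x, hx, rfl⟩

/-- Over the integers, the cyclotomic polynomial of prime power order is Eisenstein at `X - 1`. -/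
lemma cyclotomic_prime_pow_eq (p u : ℕ) (hp : p.Prime) :
    ∃ h : ℤ[X], cyclotomic (p ^ (u + 1)) ℤ =
      (X - 1) ^ (p ^ (u + 1) - p ^ u) + (p : ℤ[X]) * (1 + (X - 1) * h) := by
  have := Fact.mk hp
  have he : p ^ (u + 1) - p ^ u ≠ 0 := by
    have := Nat.pow_lt_pow_right hp.one_lt (Nat.lt_succ_self u)
    simp only [Nat.succ_eq_add_one] at this
    omega
  have h1 : (cyclotomic (p ^ (u + 1)) ℤ - (X - 1) ^ (p ^ (u + 1) - p ^ u)).map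
      (Int.castRingHom (ZMod p)) = 0 := by
    have h2 := cyclotomic_mul_prime_pow_eq (R := ZMod p) (p := p) (m := 1)
      (by simpa using hp.one_lt.ne') (k := u + 1) u.succ_pos
    simp at h2
    simp [h2]
  have h3 : (C (p : ℤ)) ∣ (cyclotomic (p ^ (u + 1)) ℤ - (X - 1) ^ (p ^ (u + 1) - p ^ u)) := by
    rw [Polynomial.C_dvd_iff_dvd_coeff]
    intro i
    have := congrArg (fun f => f.coeff i) h1
    simp only [coeff_map, coeff_zero, eq_intCast] at this
    exact (ZMod.intCast_zmod_eq_zero_iff_dvd _ _).1 this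
  obtain ⟨q, hq⟩ := h3
  have h4 : q.eval 1 = 1 := by
    have := congrArg (eval 1) hq
    simp only [eval_sub, eval_pow, eval_X, eval_one, sub_self, zero_pow he, eval_mul, eval_C,
      sub_zero] at this
    rw [eval_one_cyclotomic_prime_pow] at this
    have hp0 : (p : ℤ) ≠ 0 := by exact_mod_cast hp.ne_zero
    exact mul_left_cancel₀ hp0 (by linarith)
  obtain ⟨h, hh⟩ : (X - C 1 : ℤ[X]) ∣ q - 1 := by
    rw [dvd_iff_isRoot]; simp [IsRoot, h4]
  refine ⟨h, ?_⟩
  rw [C_1] at hh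
  rw [← hh]
  have : (C (p:ℤ) : ℤ[X]) = (p : ℤ[X]) := by simp
  rw [this] at hq
  linear_combination hq

/-- Finite `p`-torsion modules on which the variable acts as a primitive `p^(u+1)`-th root of
unity. -/
structure IsCyclotomicPModule (p u : ℕ) (M : Type*) [AddCommGroup M] [Module ℤ[X] M] : Prop where
  finite : Finite M
  exists_pow : ∃ n, ∀ x : M, p ^ n • x = 0
  cyclotomic_smul : ∀ x : M, cyclotomic (p ^ (u + 1)) ℤ • x = 0

/-- The elements of `A` fixed by the variable. -/
noncomputable def fixedIn {M : Type*} [AddCommGroup M] [Module ℤ[X] M] (A : Submodule ℤ[X] M) :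
    Submodule ℤ[X] M := A ⊓ Submodule.torsionBy ℤ[X] M (X - 1)

lemma mem_fixedIn {M : Type*} [AddCommGroup M] [Module ℤ[X] M] {A : Submodule ℤ[X] M} {x : M} :
    x ∈ fixedIn A ↔ x ∈ A ∧ (X - 1 : ℤ[X]) • x = 0 := by
  simp [fixedIn]

lemma fixedIn_mono {M : Type*} [AddCommGroup M] [Module ℤ[X] M] {A B : Submodule ℤ[X] M}
    (h : A ≤ B) : fixedIn A ≤ fixedIn B := inf_le_inf_right _ h

namespace IsCyclotomicPModule

variable {p u : ℕ} {M : Type*} [AddCommGroup M] [Module ℤ[X] M]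

lemma submodule (hM : IsCyclotomicPModule p u M) (N : Submodule ℤ[X] M) :
    IsCyclotomicPModule p u N where
  finite := have := hM.finite; inferInstance
  exists_pow := by
    obtain ⟨n, hn⟩ := hM.exists_pow
    exact ⟨n, fun x => Subtype.ext (hn x)⟩
  cyclotomic_smul := fun x => Subtype.ext (hM.cyclotomic_smul x)

lemma quotient (hM : IsCyclotomicPModule p u M) (N : Submodule ℤ[X] M) :
    IsCyclotomicPModule p u (M ⧸ N) where
  finite := have := hM.finite; Finite.of_surjective _ N.mkQ_surjective
  exists_pow := by
    obtain ⟨n, hn⟩ := hM.exists_pow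
    refine ⟨n, fun x => ?_⟩
    obtain ⟨x, rfl⟩ := N.mkQ_surjective x
    rw [← map_nsmul, hn, map_zero]
  cyclotomic_smul := by
    intro x
    obtain ⟨x, rfl⟩ := N.mkQ_surjective x
    rw [← map_smul, hM.cyclotomic_smul, map_zero]

/-- On a cyclotomic `p`-module `p` and `(X - 1)^e` agree up to a unit. -/
lemma exists_unit (hp : p.Prime) (hM : IsCyclotomicPModule p u M) :
    ∃ w w' : ℤ[X], ∀ x : M, (X - 1 : ℤ[X]) ^ (p ^ (u + 1) - p ^ u) • x = p • w • x ∧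
      p • x = (X - 1 : ℤ[X]) ^ (p ^ (u + 1) - p ^ u) • w' • x := by
  obtain ⟨h, hh⟩ := cyclotomic_prime_pow_eq p u hp
  obtain ⟨n, hn⟩ := hM.exists_pow
  set e := p ^ (u + 1) - p ^ u
  have key : ∀ x : M, (X - 1 : ℤ[X]) ^ e • x = p • (-(1 + (X - 1) * h) : ℤ[X]) • x := by
    intro x
    have := hM.cyclotomic_smul x
    rw [hh, add_smul, mul_smul, Nat.cast_smul_eq_nsmul] at this
    rw [neg_smul, smul_neg]
    exact eq_neg_of_add_eq_zero_left this
  have hnil : ∀ k : ℕ, ∀ x : M, ∃ y : M, ((X - 1 : ℤ[X]) ^ e) ^ k • x = p ^ k • y := by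
    intro k
    induction k with
    | zero => intro x; exact ⟨x, by simp⟩
    | succ k ih =>
      intro x
      obtain ⟨y, hy⟩ := ih x
      refine ⟨(-(1 + (X - 1) * h) : ℤ[X]) • y, ?_⟩
      rw [pow_succ', mul_smul, hy, smul_comm, key, pow_succ, mul_smul]
  -- X - 1 is nilpotent on M, so 1 + (X - 1)h is inverted by a finite geometric series.
  set y : ℤ[X] := -((X - 1) * h)
  have hy : ∀ x : M, y ^ (e * n) • x = 0 := by
    intro x
    have : y ^ (e * n) = (-h) ^ (e * n) * (((X - 1 : ℤ[X]) ^ e) ^ n) := by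
      rw [← pow_mul, ← mul_pow]; congr 1; simp only [y]; ring
    obtain ⟨z, hz⟩ := hnil n x
    rw [this, mul_smul, hz, hn, smul_zero]
  refine ⟨-(1 + (X - 1) * h), -∑ i ∈ Finset.range (e * n), y ^ i, fun x => ⟨key x, ?_⟩⟩
  rw [key, ← mul_smul]
  have h2 : (-(1 + (X - 1) * h) : ℤ[X]) * (-∑ i ∈ Finset.range (e * n), y ^ i)
      = 1 - y ^ (e * n) := by
    rw [← mul_neg_geom_sum y (e * n)]; simp only [y]; ring
  rw [h2, sub_smul, hy, one_smul, sub_zero]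

/-- Since p^h is a unit times (X - 1)^(eh), the fixed points of A are (X - 1)^(eh)-multiples from E.
Climbing the kernels of the powers of X - 1 costs one factor X - 1 of divisibility per level, and
p^h-torsion is reached before the factors run out. -/
lemma mem_of_fixedIn_le (hp : p.Prime) (hM : IsCyclotomicPModule p u M) {A E : Submodule ℤ[X] M}
    (hEA : E ≤ A) {h : ℕ} (hfix : fixedIn A ≤ natMul (p ^ h) E) {x : M} (hx : x ∈ A)
    (hpx : p ^ h • x = 0) : x ∈ E := by
  obtain ⟨w, w', hw⟩ := hM.exists_unit hp
  set e := p ^ (u + 1) - p ^ u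
  have h1 : ∀ k : ℕ, ∀ x : M, ((X - 1 : ℤ[X]) ^ e) ^ k • x = p ^ k • w ^ k • x := by
    intro k
    induction k with
    | zero => simp
    | succ k ih =>
      intro x
      rw [pow_succ', mul_smul, ih, smul_comm, (hw _).1, pow_succ p, mul_smul, pow_succ' w, mul_smul]
  have h2 : ∀ k : ℕ, ∀ x : M, p ^ k • x = ((X - 1 : ℤ[X]) ^ e) ^ k • w' ^ k • x := by
    intro k
    induction k with
    | zero => simp
    | succ k ih =>
      intro x
      rw [pow_succ' p, mul_smul, ih, (hw _).2, pow_succ' ((X - 1 : ℤ[X]) ^ e), mul_smul,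
        pow_succ' w', mul_smul, smul_comm w']
  have h3 : ∀ j ≤ e * h, ∀ x ∈ A, (X - 1 : ℤ[X]) ^ (j + 1) • x = 0 →
      ∃ y ∈ E, x = (X - 1 : ℤ[X]) ^ (e * h - j) • y := by
    intro j
    induction j with
    | zero =>
      intro _ x hx hx0
      obtain ⟨y, hy, rfl⟩ := mem_natMul.1 (hfix (mem_fixedIn.2 ⟨hx, by simpa using hx0⟩))
      exact ⟨w' ^ h • y, E.smul_mem _ hy, by rw [h2, ← pow_mul, Nat.sub_zero]⟩
    | succ j ih =>
      intro hj x hx hx0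
      obtain ⟨y, hy, hxy⟩ := ih (by omega) ((X - 1 : ℤ[X]) • x) (A.smul_mem _ hx)
        (by rw [← mul_smul, ← pow_succ]; exact hx0)
      -- Dividing the representation of (X - 1)x by X - 1 determines x up to a fixed point, which is
      -- itself divisible.
      have hsub : x - (X - 1 : ℤ[X]) ^ (e * h - (j + 1)) • y ∈ fixedIn A := by
        refine mem_fixedIn.2 ⟨A.sub_mem hx (A.smul_mem _ (hEA hy)), ?_⟩
        rw [smul_sub, hxy, ← mul_smul, ← pow_succ', show e * h - (j + 1) + 1 = e * h - j by omega,
          sub_self]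
      obtain ⟨z, hz, hz'⟩ := mem_natMul.1 (hfix hsub)
      refine ⟨y + (X - 1 : ℤ[X]) ^ (j + 1) • w' ^ h • z,
        E.add_mem hy (E.smul_mem _ (E.smul_mem _ hz)), ?_⟩
      rw [smul_add, ← mul_smul _ _ (w' ^ h • z), ← pow_add,
        show e * h - (j + 1) + (j + 1) = e * h by omega, pow_mul, ← h2, hz']
      abel
  obtain ⟨y, hy, hxy⟩ := h3 (e * h) le_rfl x hx (by
    rw [pow_succ', mul_smul, pow_mul, h1, smul_comm (p ^ h), hpx, smul_zero, smul_zero])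
  rw [hxy]
  exact E.smul_mem _ hy

end IsCyclotomicPModule

namespace IsCyclotomicPModule

variable {p u : ℕ} {M : Type*} [AddCommGroup M] [Module ℤ[X] M]

lemma eq_bot_of_fixedIn_eq_bot (hp : p.Prime) (hM : IsCyclotomicPModule p u M)
    {A : Submodule ℤ[X] M} (h : fixedIn A = ⊥) : A = ⊥ := by
  obtain ⟨n, hn⟩ := hM.exists_pow
  exact (Submodule.eq_bot_iff _).2 fun x hx => by
    simpa using hM.mem_of_fixedIn_le hp (bot_le : ⊥ ≤ A) (h := n) (by rw [h]; exact bot_le) hx (hn x)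

lemma sum_pow_smul (hp : p.Prime) (hM : IsCyclotomicPModule p u M) (m : M) :
    ∑ j ∈ Finset.range p, ((X : ℤ[X]) ^ p ^ u) ^ j • m = 0 := by
  have := Fact.mk hp
  rw [← Finset.sum_smul, ← cyclotomic_prime_pow_eq_geom_sum hp]
  exact hM.cyclotomic_smul m

lemma card_submodule (hp : p.Prime) (hM : IsCyclotomicPModule p u M) (A : Submodule ℤ[X] M) :
    ∃ i, Nat.card A = p ^ i := by
  have := Fact.mk hp
  have := hM.finite
  obtain ⟨n, hn⟩ := hM.exists_pow
  have h : IsPGroup p (Multiplicative A) := fun x => ⟨n, by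
    rw [← toAdd_eq_zero]
    exact Subtype.ext (hn _)⟩
  obtain ⟨i, hi⟩ := IsPGroup.iff_card.1 h
  exact ⟨i, (Nat.card_congr Multiplicative.ofAdd).trans hi⟩

lemma card_le_of_lt (hp : p.Prime) (hM : IsCyclotomicPModule p u M) {A B : Submodule ℤ[X] M}
    (h : A < B) {j : ℕ} (hB : Nat.card B ≤ p ^ (j + 1)) : Nat.card A ≤ p ^ j := by
  have := hM.finite
  obtain ⟨a, ha⟩ := hM.card_submodule hp A
  obtain ⟨b, hb⟩ := hM.card_submodule hp B
  have hlt : Nat.card A < Nat.card B := Set.ncard_lt_ncard (s := (A : Set M)) (t := B) h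
  rw [ha, hb, Nat.pow_lt_pow_iff_right hp.one_lt] at hlt
  rw [hb, Nat.pow_le_pow_iff_right hp.one_lt] at hB
  rw [ha]
  exact Nat.pow_le_pow_right hp.pos (by omega)

lemma card_fixedIn_mono (hM : IsCyclotomicPModule p u M) {A B : Submodule ℤ[X] M}
    (h : A ≤ B) : Nat.card (fixedIn A) ≤ Nat.card (fixedIn B) := by
  have := hM.finite
  exact Set.ncard_le_ncard (s := (fixedIn A : Set M)) (t := fixedIn B) (fixedIn_mono h)
    (Set.toFinite _)

lemma card_fixedIn_submodule (hM : IsCyclotomicPModule p u M) (N : Submodule ℤ[X] M) :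
    Nat.card (fixedIn (⊤ : Submodule ℤ[X] N)) ≤ Nat.card (fixedIn N) := by
  have := hM.finite
  refine Nat.card_le_card_of_injective
    (fun x => (⟨x.1.1, mem_fixedIn.2 ⟨x.1.2, ?_⟩⟩ : fixedIn N)) ?_
  · exact congrArg Subtype.val (mem_fixedIn.1 x.2).2
  · intro x y hxy
    have h : (x.1.1 : M) = y.1.1 := congrArg (fun z : fixedIn N => (z : M)) hxy
    exact Subtype.ext (Subtype.ext h)

lemma card_fixedIn_quotient (hM : IsCyclotomicPModule p u M) (N : Submodule ℤ[X] M) :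
    Nat.card (fixedIn (⊤ : Submodule ℤ[X] (M ⧸ N))) ≤
      Nat.card (fixedIn (⊤ : Submodule ℤ[X] M)) := by
  -- In a finite module the kernel of X - 1 has as many elements as its cokernel, and cokernels pass
  -- to quotients.
  have key : ∀ (K : Type _) [AddCommGroup K] [Module ℤ[X] K] [Finite K],
      Nat.card (fixedIn (⊤ : Submodule ℤ[X] K)) =
        (LinearMap.lsmul ℤ[X] K (X - 1)).toAddMonoidHom.range.index := by
    intro K _ _ _
    set f := (LinearMap.lsmul ℤ[X] K (X - 1)).toAddMonoidHom
    have h1 := f.ker.card_mul_index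
    rw [AddSubgroup.index_ker] at h1
    have h2 := f.range.card_mul_index
    rw [← h1, mul_comm] at h2
    have h3 := Nat.eq_of_mul_eq_mul_right Nat.card_pos h2
    rw [h3]
    refine Nat.card_congr (Equiv.subtypeEquivRight fun x => ?_)
    rw [mem_fixedIn]
    exact and_iff_right Submodule.mem_top
  have := hM.finite
  have : Finite (M ⧸ N) := Finite.of_surjective _ N.mkQ_surjective
  rw [key, key]
  have h : (LinearMap.lsmul ℤ[X] (M ⧸ N) (X - 1)).toAddMonoidHom.range =
      (LinearMap.lsmul ℤ[X] M (X - 1)).toAddMonoidHom.range.map N.mkQ.toAddMonoidHom := by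
    ext x
    simp only [AddMonoidHom.mem_range, AddSubgroup.mem_map]
    constructor
    · rintro ⟨y, rfl⟩
      obtain ⟨y, rfl⟩ := N.mkQ_surjective y
      exact ⟨_, ⟨y, rfl⟩, by simp⟩
    · rintro ⟨_, ⟨y, rfl⟩, rfl⟩
      exact ⟨N.mkQ y, by simp⟩
  rw [h]
  exact Nat.le_of_dvd (Nat.pos_of_ne_zero AddSubgroup.index_ne_zero_of_finite)
    (AddSubgroup.index_map_dvd _ N.mkQ_surjective)

end IsCyclotomicPModule

/-! ### Commuting equivariant actions -/

/-- A biadditive equivariant action of `V` on `M` by commuting operators. -/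
structure CommutingAction (V M : Type*) [AddCommGroup V] [Module ℤ[X] V] [AddCommGroup M]
    [Module ℤ[X] M] where
  act : V →+ M →+ M
  comm : ∀ v w m, act v (act w m) = act w (act v m)
  equivariant : ∀ v m, (X : ℤ[X]) • act v m = act ((X : ℤ[X]) • v) ((X : ℤ[X]) • m)

namespace CommutingAction

variable {p u : ℕ} {V M : Type*} [AddCommGroup V] [Module ℤ[X] V] [AddCommGroup M]
  [Module ℤ[X] M] (ρ : CommutingAction V M)

/-- The submodule `V A` generated by all `v a`. -/
noncomputable def image (A : Submodule ℤ[X] M) : Submodule ℤ[X] M :=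
  submoduleOfXStable (AddSubgroup.closure {x | ∃ v, ∃ a ∈ A, ρ.act v a = x}) (by
    intro x hx
    induction hx using AddSubgroup.closure_induction with
    | mem x hx =>
      obtain ⟨v, a, ha, rfl⟩ := hx
      rw [ρ.equivariant]
      exact AddSubgroup.subset_closure ⟨_, _, A.smul_mem _ ha, rfl⟩
    | zero => rw [smul_zero]; exact zero_mem _
    | add x y _ _ hx hy => rw [smul_add]; exact add_mem hx hy
    | neg x _ hx => rw [smul_neg]; exact neg_mem hx)

variable {ρ}

lemma act_mem_image (v : V) {A : Submodule ℤ[X] M} {a : M} (ha : a ∈ A) :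
    ρ.act v a ∈ ρ.image A :=
  AddSubgroup.subset_closure ⟨v, a, ha, rfl⟩

lemma image_le {A : Submodule ℤ[X] M} {B : AddSubgroup M} (h : ∀ v, ∀ a ∈ A, ρ.act v a ∈ B) :
    (ρ.image A).toAddSubgroup ≤ B := by
  change AddSubgroup.closure _ ≤ B
  rw [AddSubgroup.closure_le]
  rintro _ ⟨v, a, ha, rfl⟩
  exact h v a ha

lemma image_induction {A : Submodule ℤ[X] M} {P : M → Prop}
    (act : ∀ v, ∀ a ∈ A, P (ρ.act v a)) (zero : P 0) (add : ∀ x y, P x → P y → P (x + y))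
    (neg : ∀ x, P x → P (-x)) {x : M} (hx : x ∈ ρ.image A) : P x :=
  image_le (B := { carrier := {x | P x}, add_mem' := fun hx hy => add _ _ hx hy, zero_mem' := zero,
                   neg_mem' := fun hx => neg _ hx }) act hx

lemma image_mono {A B : Submodule ℤ[X] M} (h : A ≤ B) : ρ.image A ≤ ρ.image B :=
  image_le (B := (ρ.image B).toAddSubgroup) fun v _ ha => act_mem_image v (h ha)

variable (ρ)

/-- The submodule `V^i M`. -/
noncomputable def power : ℕ → Submodule ℤ[X] M
  | 0 => ⊤
  | i + 1 => ρ.image (power i)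

variable {ρ}

lemma power_antitone : Antitone ρ.power := by
  refine antitone_nat_of_succ_le fun i => ?_
  induction i with
  | zero => exact le_top
  | succ i ih => exact image_mono ih

/-! ### Elimination from the trace relation -/

variable (ρ)

/-- The product of a list of operators. -/
def listAct : List V → M →+ M
  | [] => AddMonoidHom.id M
  | v :: l => (listAct l).comp (ρ.act v)

lemma pow_smul_act (k : ℕ) (v : V) (m : M) :
    (X ^ k : ℤ[X]) • ρ.act v m = ρ.act ((X ^ k : ℤ[X]) • v) ((X ^ k : ℤ[X]) • m) := by
  induction k with
  | zero => simp
  | succ k ih => rw [pow_succ', mul_smul, ih, ρ.equivariant, ← mul_smul, ← mul_smul]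

/-- The coefficients arising by elimination of `σ, σ ^ 2, …` from the relation `∑ σ ^ j = 0`. -/
noncomputable def elim (σ : ℤ[X]) : List V → ℕ → M →+ M
  | [], _ => AddMonoidHom.id M
  | a :: l, j => (elim σ l j).comp (ρ.act (σ ^ j • a) - ρ.act (σ ^ (l.length + 1) • a))

lemma act_elim (σ : ℤ[X]) (l : List V) (j : ℕ) (v : V) (x : M) :
    ρ.act v (ρ.elim σ l j x) = ρ.elim σ l j (ρ.act v x) := by
  induction l generalizing x with
  | nil => rfl
  | cons w l ih =>
    simp only [elim, AddMonoidHom.comp_apply, ih, AddMonoidHom.sub_apply, map_sub, ρ.comm v]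

/-- The entry at which the remaining list has length j contributes the factor σ^j a - σ^j a. -/
lemma elim_eq_zero (σ : ℤ[X]) (l : List V) (j : ℕ) (hj : 1 ≤ j) (hjl : j ≤ l.length) (x : M) :
    ρ.elim σ l j x = 0 := by
  induction l generalizing x with
  | nil => simp at hjl; omega
  | cons w l ih =>
    simp only [elim, AddMonoidHom.comp_apply]
    by_cases h : j = l.length + 1
    · subst h; simp
    · exact ih (by simp at hjl; omega) _

/-- Each new entry a subtracts σ^(length + 1) a times the relation for m from the relation for a m.
Commutativity lets the operators pass through the earlier coefficients. -/
lemma sum_elim_eq_zero {σ : ℤ[X]} {p : ℕ}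
    (hσ : ∀ j v m, σ ^ j • ρ.act v m = ρ.act (σ ^ j • v) (σ ^ j • m))
    (htr : ∀ m : M, ∑ j ∈ Finset.range p, σ ^ j • m = 0) (l : List V) (m : M) :
    ∑ j ∈ Finset.range p, ρ.elim σ l j (σ ^ j • m) = 0 := by
  induction l generalizing m with
  | nil => exact htr m
  | cons a l ih =>
    have h1 := ih (ρ.act a m)
    have h2 := congrArg (ρ.act (σ ^ (l.length + 1) • a)) (ih m)
    rw [map_sum, map_zero] at h2
    simp only [hσ] at h1
    simp only [act_elim] at h2
    simp only [elim, AddMonoidHom.comp_apply, AddMonoidHom.sub_apply, map_sub,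
      Finset.sum_sub_distrib, h1, h2, sub_zero]

lemma exists_prime_nsmul_eq_sub {σ : ℤ[X]} (hp : p.Prime)
    (htr : ∀ m : V, ∑ j ∈ Finset.range p, σ ^ j • m = 0) (i : ℕ) (hi : 1 ≤ i) (hip : i < p)
    (v : V) : ∃ a : V, p • v = a - σ ^ i • a := by
  have hσ : ∀ v : V, σ ^ p • v = v := by
    intro v
    have h := mul_neg_geom_sum σ p
    have h2 : ((1 - σ) * ∑ j ∈ Finset.range p, σ ^ j) • v = 0 := by
      rw [mul_smul, Finset.sum_smul, htr, smul_zero]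
    rw [h, sub_smul, one_smul, sub_eq_zero] at h2
    exact h2.symm
  have hσk : ∀ (k : ℕ) (v : V), σ ^ (p * k) • v = v := by
    intro k
    induction k with
    | zero => simp
    | succ k ih => intro v; rw [mul_add, pow_add, mul_smul, mul_one, hσ, ih]
  -- p v is the sum of the v - σ^j v because the trace of v vanishes, and 1 - σ divides each 1 -
  -- σ^j.
  have hw : ∃ w : V, p • v = w - σ • w := by
    have h : ∀ n : ℕ, ∃ w : V, n • v - ∑ j ∈ Finset.range n, σ ^ j • v = w - σ • w := by
      intro n
      induction n with
      | zero => exact ⟨0, by simp⟩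
      | succ n ih =>
        obtain ⟨w, hw⟩ := ih
        refine ⟨w + (∑ j ∈ Finset.range n, σ ^ j) • v, ?_⟩
        have h2 : v - σ ^ n • v = (∑ j ∈ Finset.range n, σ ^ j) • v -
            σ • (∑ j ∈ Finset.range n, σ ^ j) • v := by
          rw [← mul_smul, ← sub_smul, ← one_sub_mul, mul_neg_geom_sum, sub_smul, one_smul]
        rw [Finset.sum_range_succ, succ_nsmul, smul_add, add_sub_add_comm, hw, h2]
        abel
    obtain ⟨w, hw⟩ := h p
    exact ⟨w, by rw [← hw, htr, sub_zero]⟩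
  obtain ⟨w, hw⟩ := hw
  have hcop : Nat.Coprime i p := by
    rw [Nat.coprime_comm]
    exact Nat.coprime_of_lt_prime (by omega) hip hp
  -- As σ = (σ^i)^i' on V, 1 - σ is a multiple of 1 - σ^i.
  obtain ⟨i', hi'⟩ := Nat.exists_mul_mod_eq_one_of_coprime hcop hp.one_lt
  refine ⟨(∑ l ∈ Finset.range i', (σ ^ i) ^ l) • w, ?_⟩
  have h3 : σ • w = (σ ^ i) ^ i' • w := by
    rw [← pow_mul, ← Nat.mod_add_div (i * i') p, hi'.2, pow_add, mul_smul, hσk, pow_one]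
  rw [hw, h3, ← mul_smul, ← sub_smul, ← one_sub_mul, mul_neg_geom_sum, sub_smul, one_smul]

lemma exists_listAct_eq_elim {σ : ℤ[X]} (hp : p.Prime)
    (htr : ∀ m : V, ∑ j ∈ Finset.range p, σ ^ j • m = 0) (l : List V) (hl : l.length < p) :
    ∃ l' : List V, l'.length = l.length ∧
      ∀ x, p ^ l.length • ρ.listAct l x = ρ.elim σ l' 0 x := by
  induction l with
  | nil => exact ⟨[], rfl, fun x => by simp [listAct, elim]⟩
  | cons v l ih =>
    simp only [List.length_cons] at hl
    obtain ⟨l', hl', h⟩ := ih (by omega)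
    obtain ⟨a, ha⟩ := exists_prime_nsmul_eq_sub hp htr (l.length + 1) (by omega) hl v
    refine ⟨a :: l', by simp [hl'], fun x => ?_⟩
    simp only [elim, AddMonoidHom.comp_apply, listAct, List.length_cons, pow_zero, one_smul, hl']
    rw [← map_sub, ← ha, ← h, map_nsmul, AddMonoidHom.nsmul_apply, map_nsmul, pow_succ, mul_smul]

/-- With p - 1 operators, elimination removes all terms of the trace relation except j = 0. Its
coefficient is a product of factors a - σ^i a with 1 ≤ i < p, which can be chosen as p times any
given operators. -/
lemma pow_smul_power_eq_zero (hp : p.Prime) (hV : IsCyclotomicPModule p u V)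
    (hM : IsCyclotomicPModule p u M) {x : M} (hx : x ∈ ρ.power (p - 1)) :
    p ^ (p - 1) • x = 0 := by
  have h0 : ∀ l : List V, l.length = p - 1 → ∀ m, p ^ (p - 1) • ρ.listAct l m = 0 := by
    intro l hl m
    have hp1 := hp.one_lt
    obtain ⟨l', hl', h⟩ := ρ.exists_listAct_eq_elim hp (hV.sum_pow_smul hp) l (by omega)
    have h2 := ρ.sum_elim_eq_zero (σ := (X : ℤ[X]) ^ p ^ u) (p := p)
      (fun j v m => by rw [← pow_mul]; exact ρ.pow_smul_act _ v m) (hM.sum_pow_smul hp) l' m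
    rw [Finset.sum_eq_single_of_mem 0 (Finset.mem_range.2 hp.pos)] at h2
    · rw [← hl, h]; simpa using h2
    · intro j hj hj0
      rw [Finset.mem_range] at hj
      exact ρ.elim_eq_zero _ _ _ (by omega) (by omega) _
  have h1 : ∀ i : ℕ, ∀ x ∈ ρ.power i, ∀ l : List V, l.length + i = p - 1 →
      p ^ (p - 1) • ρ.listAct l x = 0 := by
    intro i
    induction i with
    | zero => intro x _ l hl; exact h0 l hl x
    | succ i ih =>
      intro x hx l hl
      refine image_induction (P := fun x => p ^ (p - 1) • ρ.listAct l x = 0) ?_ (by simp) ?_ ?_ hx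
      · intro v a ha
        exact ih a ha (v :: l) (by simp only [List.length_cons]; omega)
      · intro x y hx hy; simp only [map_add, smul_add, hx, hy, add_zero]
      · intro x hx; simp only [map_neg, smul_neg, hx, neg_zero]
  exact h1 (p - 1) x hx [] (by simp)

end CommutingAction

/-! ### Few fixed points: trading p - 1 factors for d -/

namespace CommutingAction

variable {p u : ℕ} {V M : Type*} [AddCommGroup V] [Module ℤ[X] V] [AddCommGroup M]
  [Module ℤ[X] M] (ρ : CommutingAction V M)

/-- If the fixed points of `p^(m-pT) V^i M` lie in `p^(m-T) V^(i+1) M`, then nilpotency of the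
action kills `p^(m-T) V^i M`. -/
lemma pow_smul_eq_zero_of_fixedIn_le (hp : p.Prime) (hV : IsCyclotomicPModule p u V)
    (hM : IsCyclotomicPModule p u M) {m T i : ℕ} (hm : ∀ x : M, p ^ m • x = 0)
    (hT : p * T + p ≤ m)
    (hfix : fixedIn (natMul (p ^ (m - p * T)) (ρ.power i)) ≤
      natMul (p ^ (m - T)) (ρ.power (i + 1))) {x : M} (hx : x ∈ ρ.power i) :
    p ^ (m - T) • x = 0 := by
  have hTp : T ≤ p * T := Nat.le_mul_of_pos_left T hp.pos
  have hE : natMul (p ^ (m - p * T)) (ρ.power (i + 1)) ≤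
      natMul (p ^ (m - p * T)) (ρ.power i) := by
    intro y hy
    obtain ⟨z, hz, rfl⟩ := mem_natMul.1 hy
    exact nsmul_mem_natMul _ (power_antitone (Nat.le_succ i) hz)
  -- This is the hypothesis of `mem_of_fixedIn_le` with h = pT - T. It yields p^(m-pT+T) V^i M ⊆
  -- p^(m-pT) V^(i+1) M.
  have hfix' : fixedIn (natMul (p ^ (m - p * T)) (ρ.power i)) ≤
      natMul (p ^ (p * T - T)) (natMul (p ^ (m - p * T)) (ρ.power (i + 1))) := by
    refine hfix.trans fun y hy => ?_
    obtain ⟨z, hz, rfl⟩ := mem_natMul.1 hy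
    refine mem_natMul.2 ⟨_, nsmul_mem_natMul _ hz, ?_⟩
    rw [← mul_smul, ← pow_add]
    congr 2
    omega
  have h1 : ∀ j, ∀ x ∈ ρ.power (i + j), ∃ y ∈ ρ.power (i + j + 1),
      p ^ (m - p * T + T) • x = p ^ (m - p * T) • y := by
    intro j
    induction j with
    | zero =>
      intro x hx
      have h2 : p ^ (m - p * T + T) • x ∈ natMul (p ^ (m - p * T)) (ρ.power (i + 1)) := by
        refine hM.mem_of_fixedIn_le hp hE hfix' ?_ ?_
        · rw [pow_add, mul_smul]
          exact nsmul_mem_natMul _ ((ρ.power i).smul_of_tower_mem _ hx)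
        · rw [← mul_smul, ← pow_add, show p * T - T + (m - p * T + T) = m by omega, hm]
      obtain ⟨y, hy, hxy⟩ := mem_natMul.1 h2
      exact ⟨y, hy, hxy.symm⟩
    | succ j ih =>
      intro x hx
      refine image_induction (P := fun x => ∃ y ∈ ρ.power (i + (j + 1) + 1),
        p ^ (m - p * T + T) • x = p ^ (m - p * T) • y) ?_ ?_ ?_ ?_ hx
      · intro v a ha
        obtain ⟨y, hy, hay⟩ := ih a ha
        exact ⟨ρ.act v y, act_mem_image v hy, by rw [← map_nsmul, hay, map_nsmul]⟩
      · exact ⟨0, zero_mem _, by simp⟩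
      · rintro x y ⟨a, ha, hxa⟩ ⟨b, hb, hyb⟩
        exact ⟨a + b, add_mem ha hb, by rw [smul_add, hxa, hyb, smul_add]⟩
      · rintro x ⟨a, ha, hxa⟩
        exact ⟨-a, neg_mem ha, by rw [smul_neg, hxa, smul_neg]⟩
  have h2 : ∀ j, ∀ x ∈ ρ.power i, ∃ y ∈ ρ.power (i + j),
      p ^ (m - p * T + j * T) • x = p ^ (m - p * T) • y := by
    intro j
    induction j with
    | zero => intro x hx; exact ⟨x, hx, by simp⟩
    | succ j ih =>
      intro x hx
      obtain ⟨y, hy, hxy⟩ := ih x hx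
      obtain ⟨z, hz, hyz⟩ := h1 j y hy
      refine ⟨z, hz, ?_⟩
      rw [← hyz, pow_add _ _ T, mul_comm _ (p ^ T), mul_smul, ← hxy, ← mul_smul, ← pow_add]
      congr 2
      ring
  obtain ⟨y, hy, hxy⟩ := h2 (p - 1) x hx
  -- After p - 1 rounds at cost T each, the remaining p^(m-pT) contains the factor p^(p-1) that
  -- kills V^(p-1) M.
  have hexp : m - p * T + (p - 1) * T = m - T := by
    have : (p - 1) * T + T = p * T := by
      rw [← Nat.succ_mul, Nat.succ_eq_add_one, Nat.sub_add_cancel hp.one_le]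
    omega
  rw [hexp] at hxy
  rw [hxy, show m - p * T = (m - p * T - (p - 1)) + (p - 1) by omega, pow_add, mul_smul,
    ρ.pow_smul_power_eq_zero hp hV hM (power_antitone (Nat.le_add_left (p - 1) i) hy), smul_zero]

/-- A module with at most `p^d` fixed points: the `d`-th power of the action is divisible by
a prescribed power of `p`, provided the exponent is large enough. -/
lemma pow_smul_power_eq_zero_of_card (hp : p.Prime) (hV : IsCyclotomicPModule p u V)
    (hM : IsCyclotomicPModule p u M) {d ε m : ℕ} (hm : ∀ x : M, p ^ m • x = 0)
    (hfix : Nat.card (fixedIn (⊤ : Submodule ℤ[X] M)) ≤ p ^ d) (hlarge : p ^ d * ε + p ≤ m)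
    {x : M} (hx : x ∈ ρ.power d) : p ^ (m - ε) • x = 0 := by
  have := hM.finite
  -- Each further factor from V lowers the fixed-point bound by p. If the fixed points do not
  -- shrink, the preceding lemma with T = p^j ε makes the submodule zero.
  have key : ∀ i j, i + j = d →
      Nat.card (fixedIn (natMul (p ^ (m - p ^ j * ε)) (ρ.power i))) ≤ p ^ j := by
    intro i
    induction i with
    | zero =>
      intro j hj
      obtain rfl : j = d := by omega
      exact (hM.card_fixedIn_mono le_top).trans hfix
    | succ i ih =>
      intro j hj
      have hle : p ^ (j + 1) ≤ p ^ d := Nat.pow_le_pow_right hp.pos (by omega)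
      have hle' := Nat.mul_le_mul_right ε hle
      rw [pow_succ', mul_assoc] at hle'
      have h1 := ih (j + 1) (by omega)
      rw [pow_succ' p j, mul_assoc, ← pow_succ'] at h1
      have hTp : p ^ j * ε ≤ p * (p ^ j * ε) := Nat.le_mul_of_pos_left _ hp.pos
      have hsub : natMul (p ^ (m - p ^ j * ε)) (ρ.power (i + 1)) ≤
          natMul (p ^ (m - p * (p ^ j * ε))) (ρ.power i) := by
        intro y hy
        obtain ⟨z, hz, rfl⟩ := mem_natMul.1 hy
        rw [show m - p ^ j * ε = (m - p * (p ^ j * ε)) + (p * (p ^ j * ε) - p ^ j * ε) by omega,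
          pow_add, mul_smul]
        exact nsmul_mem_natMul _
          (Submodule.smul_of_tower_mem _ _ (power_antitone (Nat.le_succ i) hz))
      rcases (fixedIn_mono hsub).eq_or_lt with heq | hlt
      · have hz : natMul (p ^ (m - p ^ j * ε)) (ρ.power (i + 1)) = ⊥ := by
          refine (Submodule.eq_bot_iff _).2 fun y hy => ?_
          obtain ⟨z, hz, rfl⟩ := mem_natMul.1 hy
          refine ρ.pow_smul_eq_zero_of_fixedIn_le hp hV hM hm (by omega) ?_
            (power_antitone (Nat.le_succ i) hz)
          rw [← heq]
          exact inf_le_left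
        rw [hz]
        have h2 : fixedIn (⊥ : Submodule ℤ[X] M) = ⊥ := by simp [fixedIn]
        rw [h2]
        simpa using Nat.one_le_pow _ _ hp.pos
      · exact hM.card_le_of_lt hp hlt h1
  have h1 := key d 0 (by omega)
  simp only [pow_zero, one_mul] at h1
  have h2 : natMul (p ^ (m - ε)) (ρ.power d) = ⊥ := by
    refine hM.eq_bot_of_fixedIn_eq_bot hp ?_
    rw [← Submodule.subsingleton_iff_eq_bot]
    exact Finite.card_le_one_iff_subsingleton.1 h1
  have h3 := nsmul_mem_natMul (p ^ (m - ε)) hx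
  rw [h2] at h3
  simpa using h3

/-! ### Dividing an action by a power of p -/

/-- The restriction of an action to an invariant submodule. -/
noncomputable def restrict (N : Submodule ℤ[X] M) (hN : ∀ v, ∀ x ∈ N, ρ.act v x ∈ N) :
    CommutingAction V N where
  act := AddMonoidHom.mk' (fun v => AddMonoidHom.mk' (fun x => ⟨ρ.act v x, hN v x x.2⟩)
    fun x y => Subtype.ext (by simp)) fun v w => by ext x; simp
  comm v w x := Subtype.ext (ρ.comm v w x)
  equivariant v x := Subtype.ext (ρ.equivariant v x)

lemma coe_restrict_act (N : Submodule ℤ[X] M) (hN : ∀ v, ∀ x ∈ N, ρ.act v x ∈ N) (v : V) (x : N) :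
    ((ρ.restrict N hN).act v x : M) = ρ.act v x := rfl

/-- Quotients by p^k are unique up to p^k-torsion, which vanishes modulo p^m N. The exponent is 2k
because commutativity compares two successive divisions. -/
lemma exists_divided (N : Submodule ℤ[X] M) {k m : ℕ}
    (hN : ∀ v, ∀ x ∈ N, ∃ y ∈ N, ρ.act v x = p ^ k • y)
    (htor : ∀ x ∈ N, p ^ (2 * k) • x = 0 → ∃ y ∈ N, x = p ^ m • y) :
    ∃ ρ' : CommutingAction V (N ⧸ natMul (p ^ m) (⊤ : Submodule ℤ[X] N)),
      ∀ (v : V) (x y : N), ρ.act v x = p ^ k • (y : M) →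
        ρ'.act v (Submodule.Quotient.mk x) = Submodule.Quotient.mk y := by
  set Z := natMul (p ^ m) (⊤ : Submodule ℤ[X] N)
  have hmem : ∀ x : N, p ^ (2 * k) • (x : M) = 0 → x ∈ Z := by
    intro x hx
    obtain ⟨y, hy, hxy⟩ := htor x x.2 hx
    exact mem_natMul.2 ⟨⟨y, hy⟩, trivial, Subtype.ext hxy.symm⟩
  have huniq2 : ∀ x y : N, p ^ (2 * k) • (x : M) = p ^ (2 * k) • (y : M) →
      (Submodule.Quotient.mk x : N ⧸ Z) = Submodule.Quotient.mk y := by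
    intro x y h
    rw [Submodule.Quotient.eq]
    exact hmem _ (by rw [Submodule.coe_sub, smul_sub, h, sub_self])
  have huniq : ∀ x y : N, p ^ k • (x : M) = p ^ k • (y : M) →
      (Submodule.Quotient.mk x : N ⧸ Z) = Submodule.Quotient.mk y := by
    intro x y h
    refine huniq2 x y ?_
    rw [two_mul, pow_add, mul_smul, h, ← mul_smul]
  have hN' : ∀ (v : V) (x : N), ∃ y : N, ρ.act v x = p ^ k • (y : M) := by
    intro v x
    obtain ⟨y, hy, h⟩ := hN v x x.2
    exact ⟨⟨y, hy⟩, h⟩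
  choose D hD using hN'
  let f : V → N →+ N ⧸ Z := fun v => AddMonoidHom.mk' (fun x => Submodule.Quotient.mk (D v x)) (by
    intro x y
    rw [← Submodule.Quotient.mk_add]
    refine huniq _ _ ?_
    rw [← hD, Submodule.coe_add, Submodule.coe_add, map_add, hD, hD, smul_add])
  have hf : ∀ (v : V) (x y : N), ρ.act v x = p ^ k • (y : M) →
      f v x = Submodule.Quotient.mk y := by
    intro v x y h
    exact huniq _ _ (by rw [← hD, h])
  let g : V → N ⧸ Z →+ N ⧸ Z := fun v => QuotientAddGroup.lift Z.toAddSubgroup (f v) (by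
    intro x hx
    obtain ⟨y, -, rfl⟩ := mem_natMul.1 hx
    rw [AddMonoidHom.mem_ker, hf v _ (p ^ m • D v y)]
    · rw [Submodule.Quotient.mk_eq_zero]
      exact nsmul_mem_natMul _ trivial
    · have h1 : ((p ^ m • y : N) : M) = p ^ m • (y : M) := rfl
      have h2 : ((p ^ m • D v y : N) : M) = p ^ m • (D v y : M) := rfl
      rw [h1, h2, map_nsmul, hD, smul_comm])
  have hg : ∀ (v : V) (x y : N), ρ.act v x = p ^ k • (y : M) →
      g v (Submodule.Quotient.mk x) = Submodule.Quotient.mk y := hf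
  have hgD : ∀ v x, g v (Submodule.Quotient.mk x) = Submodule.Quotient.mk (D v x) :=
    fun v x => hg v x _ (hD v x)
  refine ⟨⟨AddMonoidHom.mk' g ?_, ?_, ?_⟩, hg⟩
  · intro v w
    ext x
    obtain ⟨x, rfl⟩ := Submodule.Quotient.mk_surjective _ x
    rw [AddMonoidHom.add_apply, hgD v, hgD w, ← Submodule.Quotient.mk_add]
    refine hg _ _ _ ?_
    rw [map_add, AddMonoidHom.add_apply, hD, hD, Submodule.coe_add, smul_add]
  · intro v w x
    obtain ⟨x, rfl⟩ := Submodule.Quotient.mk_surjective _ x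
    simp only [AddMonoidHom.mk'_apply]
    rw [hgD w, hgD v, hgD v, hgD w]
    refine huniq2 _ _ ?_
    rw [two_mul, pow_add, mul_smul, mul_smul, ← hD, ← hD, ← map_nsmul, ← map_nsmul, ← hD, ← hD,
      ρ.comm]
  · intro v x
    obtain ⟨x, rfl⟩ := Submodule.Quotient.mk_surjective _ x
    simp only [AddMonoidHom.mk'_apply]
    rw [hgD, ← Submodule.Quotient.mk_smul, ← Submodule.Quotient.mk_smul]
    refine (hg _ _ _ ?_).symm
    rw [Submodule.coe_smul, Submodule.coe_smul, ← ρ.equivariant, hD, smul_comm]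

end CommutingAction

/-! ### Bootstrapping divisibility through the divided action -/

namespace CommutingAction

variable {p u : ℕ} {V M : Type*} [AddCommGroup V] [Module ℤ[X] V] [AddCommGroup M]
  [Module ℤ[X] M] (ρ : CommutingAction V M)

/-- The sum of the submodules `p^((d-i)k) V^i M` for `i ≤ d`. -/
noncomputable def stair (p d k : ℕ) : Submodule ℤ[X] M :=
  ⨆ i : Fin (d + 1), natMul (p ^ ((d - i) * k)) (ρ.power i)

variable {ρ}

lemma smul_mem_stair {d k i : ℕ} (hi : i ≤ d) {x : M} (hx : x ∈ ρ.power i) :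
    p ^ ((d - i) * k) • x ∈ ρ.stair p d k :=
  Submodule.mem_iSup_of_mem (⟨i, by omega⟩ : Fin (d + 1)) (nsmul_mem_natMul _ hx)

lemma stair_induction {d k : ℕ} {P : M → Prop}
    (mem : ∀ i ≤ d, ∀ x ∈ ρ.power i, P (p ^ ((d - i) * k) • x)) (zero : P 0)
    (add : ∀ x y, P x → P y → P (x + y)) {x : M} (hx : x ∈ ρ.stair p d k) : P x := by
  refine Submodule.iSup_induction _ (motive := P) hx ?_ zero add
  intro i y hy
  obtain ⟨z, hz, rfl⟩ := mem_natMul.1 hy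
  exact mem i (by omega) z hz

/-- One factor from V climbs one stair and thereby releases p^k. Only the top stair needs the
hypothesis. -/
lemma act_mem_of_mem_stair {d k : ℕ} (h : ρ.power (d + 1) ≤ natMul (p ^ k) (ρ.stair p d k))
    (v : V) {x : M} (hx : x ∈ ρ.stair p d k) : ρ.act v x ∈ natMul (p ^ k) (ρ.stair p d k) := by
  refine stair_induction (P := fun x => ρ.act v x ∈ natMul (p ^ k) (ρ.stair p d k)) ?_ (by simp)
    (fun x y hx hy => by rw [map_add]; exact add_mem hx hy) hx
  intro i hi x hx
  have hvx : ρ.act v x ∈ ρ.power (i + 1) := act_mem_image v hx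
  rw [map_nsmul]
  rcases hi.eq_or_lt with rfl | hlt
  · simpa using h hvx
  · rw [show (d - i) * k = k + (d - (i + 1)) * k by
      rw [show d - i = (d - (i + 1)) + 1 by omega]; ring, pow_add, mul_smul]
    exact nsmul_mem_natMul _ (smul_mem_stair hlt hvx)

lemma pow_smul_mem_stair_succ {d k : ℕ} {x : M} (hx : x ∈ ρ.stair p d k) :
    p ^ d • x ∈ ρ.stair p d (k + 1) := by
  refine stair_induction (P := fun x => p ^ d • x ∈ ρ.stair p d (k + 1)) ?_ (by simp)
    (fun x y hx hy => by rw [smul_add]; exact add_mem hx hy) hx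
  intro i hi x hx
  rw [← mul_smul, ← pow_add, show d + (d - i) * k = i + (d - i) * (k + 1) by
    rw [mul_add, mul_one]; omega, pow_add, mul_smul]
  exact Submodule.smul_of_tower_mem _ _ (smul_mem_stair hi hx)

variable (ρ)

/-- Dividing the action on the stair by p^k keeps the bound on fixed points, so the d-th power of
the divided action is divisible by p^(d+1). Passing from stair k to stair k + 1 spends p^d, which
leaves a gain of one p. -/
lemma power_succ_le_stair_succ (hp : p.Prime) (hV : IsCyclotomicPModule p u V)
    (hM : IsCyclotomicPModule p u M) {a d k : ℕ}
    (hflat : ∀ j ≤ a, ∀ x : M, p ^ j • x = 0 → ∃ y : M, x = p ^ (a - j) • y)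
    (hfix : Nat.card (fixedIn (⊤ : Submodule ℤ[X] M)) ≤ p ^ d)
    (h : ρ.power (d + 1) ≤ natMul (p ^ k) (ρ.stair p d k))
    (ha : (d + 2) * k + (p ^ d * (d + 1) + p) ≤ a) :
    ρ.power (d + 1) ≤ natMul (p ^ (k + 1)) (ρ.stair p d (k + 1)) := by
  set N := ρ.stair p d k
  obtain ⟨m, hm⟩ : ∃ m, a = m + (d + 2) * k := ⟨a - (d + 2) * k, by omega⟩
  have hdk : (d + 2) * k = d * k + 2 * k := by ring
  have hone : d + 1 ≤ p ^ d * (d + 1) := Nat.le_mul_of_pos_left _ (pow_pos hp.pos d)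
  have hbase : ∀ x : M, p ^ (d * k) • x ∈ N := fun x =>
    smul_mem_stair (i := 0) (Nat.zero_le d) (show x ∈ ρ.power 0 from trivial)
  -- Since p^(dk) M ⊆ N, the divisibility of torsion survives in N with a - dk = m + 2k in place of
  -- a.
  have htor : ∀ j ≤ m + 2 * k, ∀ x : M, p ^ j • x = 0 → ∃ y ∈ N, x = p ^ (m + 2 * k - j) • y := by
    intro j hj x hx
    obtain ⟨y, hy⟩ := hflat j (by omega) x hx
    refine ⟨p ^ (d * k) • y, hbase y, ?_⟩
    rw [hy, ← mul_smul, ← pow_add]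
    congr 2
    omega
  obtain ⟨ρ', hρ'⟩ := ρ.exists_divided N (k := k) (m := m)
    (fun v x hx => by
      obtain ⟨y, hy, hxy⟩ := mem_natMul.1 (act_mem_of_mem_stair h v hx)
      exact ⟨y, hy, hxy.symm⟩)
    (fun x _ hx => by simpa using htor (2 * k) (by omega) x hx)
  have hN := hM.submodule N
  have hY := hN.quotient (natMul (p ^ m) (⊤ : Submodule ℤ[X] N))
  have hYm : ∀ y : N ⧸ natMul (p ^ m) (⊤ : Submodule ℤ[X] N), p ^ m • y = 0 := by
    intro y
    obtain ⟨y, rfl⟩ := Submodule.Quotient.mk_surjective _ y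
    exact (Submodule.Quotient.mk_eq_zero _).2 (nsmul_mem_natMul _ trivial)
  have hYfix : Nat.card (fixedIn
      (⊤ : Submodule ℤ[X] (N ⧸ natMul (p ^ m) (⊤ : Submodule ℤ[X] N)))) ≤ p ^ d :=
    (hN.card_fixedIn_quotient _).trans ((hM.card_fixedIn_submodule N).trans
      ((hM.card_fixedIn_mono le_top).trans hfix))
  have hdiv : ∀ x : N, (Submodule.Quotient.mk x : N ⧸ natMul (p ^ m) (⊤ : Submodule ℤ[X] N)) ∈
      ρ'.power d → ∃ y ∈ N, (x : M) = p ^ (d + 1) • y := by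
    intro x hx
    have h1 := ρ'.pow_smul_power_eq_zero_of_card hp hV hY (ε := d + 1) hYm hYfix (by omega) hx
    rw [← Submodule.Quotient.mk_smul, Submodule.Quotient.mk_eq_zero] at h1
    obtain ⟨z, -, hz⟩ := mem_natMul.1 h1
    have hz' : p ^ m • (z : M) = p ^ (m - (d + 1)) • (x : M) := congrArg Subtype.val hz
    -- The error x - p^(d+1) z is torsion of exponent m - (d+1), hence divisible by p^(d+1+2k) in N.
    obtain ⟨y, hy, hxy⟩ := htor (m - (d + 1)) (by omega) ((x : M) - p ^ (d + 1) • (z : M)) (by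
      rw [smul_sub, ← mul_smul, ← pow_add, show m - (d + 1) + (d + 1) = m by omega, hz', sub_self])
    refine ⟨z + p ^ (2 * k) • y, add_mem z.2 (Submodule.smul_of_tower_mem _ _ hy), ?_⟩
    rw [show m + 2 * k - (m - (d + 1)) = (d + 1) + 2 * k by omega, pow_add _ (d + 1),
      mul_smul] at hxy
    rw [smul_add, ← hxy]
    abel
  -- Each divided factor absorbs p^k, which is the drop in exponent from stair i to stair i + 1.
  have htrack : ∀ i (hi : i ≤ d) (x : M) (hx : x ∈ ρ.power i),
      (Submodule.Quotient.mk (⟨p ^ ((d - i) * k) • x, smul_mem_stair hi hx⟩ : N) :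
        N ⧸ natMul (p ^ m) (⊤ : Submodule ℤ[X] N)) ∈ ρ'.power i := by
    intro i
    induction i with
    | zero => intro _ x _; trivial
    | succ i ih =>
      intro hi x hx
      have h2 : ∃ z : N, (z : M) = p ^ ((d - (i + 1)) * k) • x ∧
          (Submodule.Quotient.mk z : N ⧸ natMul (p ^ m) (⊤ : Submodule ℤ[X] N)) ∈
            ρ'.power (i + 1) := by
        refine image_induction (P := fun x => ∃ z : N, (z : M) = p ^ ((d - (i + 1)) * k) • x ∧
          (Submodule.Quotient.mk z : N ⧸ natMul (p ^ m) (⊤ : Submodule ℤ[X] N)) ∈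
            ρ'.power (i + 1)) ?_ ?_ ?_ ?_ hx
        · intro v y hy
          refine ⟨⟨p ^ ((d - (i + 1)) * k) • ρ.act v y,
            smul_mem_stair hi (act_mem_image v hy)⟩, rfl, ?_⟩
          rw [← hρ' v ⟨p ^ ((d - i) * k) • y, smul_mem_stair (by omega) hy⟩]
          · exact act_mem_image v (ih (by omega) y hy)
          · simp only [map_nsmul]
            rw [← mul_smul, ← pow_add]
            congr 2
            rw [show d - i = (d - (i + 1)) + 1 by omega]
            ring
        · exact ⟨0, by simp, by simp⟩
        · rintro x y ⟨a, ha, ha'⟩ ⟨b, hb, hb'⟩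
          refine ⟨a + b, by rw [Submodule.coe_add, ha, hb, smul_add], ?_⟩
          rw [Submodule.Quotient.mk_add]
          exact add_mem ha' hb'
        · rintro x ⟨a, ha, ha'⟩
          refine ⟨-a, by rw [Submodule.coe_neg, ha, smul_neg], ?_⟩
          rw [Submodule.Quotient.mk_neg]
          exact neg_mem ha'
      obtain ⟨z, hz, hz'⟩ := h2
      have h3 : (⟨p ^ ((d - (i + 1)) * k) • x, smul_mem_stair hi hx⟩ : N) = z :=
        Subtype.ext hz.symm
      rw [h3]
      exact hz'
  refine image_le (B := (natMul (p ^ (k + 1)) (ρ.stair p d (k + 1))).toAddSubgroup) ?_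
  intro v y hy
  have hyN : y ∈ N := by simpa using smul_mem_stair (p := p) (k := k) le_rfl hy
  obtain ⟨z, hz, hyz⟩ := mem_natMul.1 (act_mem_of_mem_stair h v hyN)
  have h1 : (Submodule.Quotient.mk ⟨y, hyN⟩ :
      N ⧸ natMul (p ^ m) (⊤ : Submodule ℤ[X] N)) ∈ ρ'.power d := by
    have := htrack d le_rfl y hy
    simpa using this
  have h2 : (Submodule.Quotient.mk ⟨z, hz⟩ :
      N ⧸ natMul (p ^ m) (⊤ : Submodule ℤ[X] N)) ∈ ρ'.power d := by
    rw [← hρ' v ⟨y, hyN⟩ ⟨z, hz⟩ hyz.symm]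
    exact power_antitone (Nat.le_succ d) (act_mem_image v h1)
  obtain ⟨w, hw, hzw⟩ := hdiv _ h2
  change ρ.act v y ∈ natMul (p ^ (k + 1)) (ρ.stair p d (k + 1))
  have hzw' : z = p ^ (d + 1) • w := hzw
  rw [← hyz, hzw', ← mul_smul, ← pow_add, show k + (d + 1) = (k + 1) + d by omega,
    pow_add _ (k + 1), mul_smul]
  exact nsmul_mem_natMul _ (pow_smul_mem_stair_succ hw)

lemma power_add_le {n i j : ℕ} (h : ∀ x ∈ ρ.power i, ∃ y : M, x = n • y) :
    ∀ x ∈ ρ.power (i + j), ∃ y ∈ ρ.power j, x = n • y := by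
  induction j with
  | zero => intro x hx; obtain ⟨y, hy⟩ := h x hx; exact ⟨y, trivial, hy⟩
  | succ j ih =>
    intro x hx
    refine image_induction (P := fun x => ∃ y ∈ ρ.power (j + 1), x = n • y) ?_
      ⟨0, zero_mem _, by simp⟩ ?_ ?_ hx
    · intro v a ha
      obtain ⟨y, hy, rfl⟩ := ih a ha
      exact ⟨ρ.act v y, act_mem_image v hy, map_nsmul _ _ _⟩
    · rintro x y ⟨a, ha, rfl⟩ ⟨b, hb, rfl⟩
      exact ⟨a + b, add_mem ha hb, (smul_add _ _ _).symm⟩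
    · rintro x ⟨a, ha, rfl⟩
      exact ⟨-a, neg_mem ha, (smul_neg _ _).symm⟩

/-- Bootstrapping makes V^(d+1) M divisible by about p^((a-B)/(d+2)). Repeating this d + 2 times
recovers all of a up to the constant B. -/
lemma pow_smul_mem_of_flat (hp : p.Prime) (hV : IsCyclotomicPModule p u V)
    (hM : IsCyclotomicPModule p u M) {a d : ℕ}
    (hflat : ∀ j ≤ a, ∀ x : M, p ^ j • x = 0 → ∃ y : M, x = p ^ (a - j) • y)
    (hfix : Nat.card (fixedIn (⊤ : Submodule ℤ[X] M)) ≤ p ^ d) {x : M}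
    (hx : x ∈ ρ.power ((d + 1) * (d + 2))) :
    ∃ y : M, p ^ (p ^ d * (d + 1) + p) • x = p ^ a • y := by
  set B := p ^ d * (d + 1) + p
  by_cases haB : a < B
  · exact ⟨p ^ (B - a) • x, by rw [← mul_smul, ← pow_add, show a + (B - a) = B by omega]⟩
  -- One more than the last k at which the bootstrap step applies; this also makes K(d + 2) exceed a
  -- - B.
  set K := (a - B) / (d + 2) + 1 with hK
  have hC : ∀ k ≤ K, ρ.power (d + 1) ≤ natMul (p ^ k) (ρ.stair p d k) := by
    intro k
    induction k with
    | zero =>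
      intro _ x hx
      have h1 := smul_mem_stair (p := p) (k := 0) le_rfl (power_antitone (Nat.le_succ d) hx)
      exact mem_natMul.2 ⟨x, by simpa using h1, by simp⟩
    | succ k ih =>
      intro hk
      refine ρ.power_succ_le_stair_succ hp hV hM hflat hfix (ih (by omega)) ?_
      have h1 : (d + 2) * k ≤ (d + 2) * ((a - B) / (d + 2)) := Nat.mul_le_mul_left _ (by omega)
      have h2 := Nat.mul_div_le (a - B) (d + 2)
      omega
  have hdiv : ∀ x ∈ ρ.power (d + 1), ∃ y : M, x = p ^ K • y := by
    intro x hx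
    obtain ⟨y, -, hy⟩ := mem_natMul.1 (hC K le_rfl hx)
    exact ⟨y, hy.symm⟩
  have hiter : ∀ n, ∀ x ∈ ρ.power ((d + 1) * n), ∃ y : M, x = p ^ (K * n) • y := by
    intro n
    induction n with
    | zero => intro x _; exact ⟨x, by simp⟩
    | succ n ih =>
      intro x hx
      rw [mul_add, mul_one, add_comm] at hx
      obtain ⟨y, hy, rfl⟩ := ρ.power_add_le hdiv x hx
      obtain ⟨z, rfl⟩ := ih y hy
      exact ⟨z, by rw [← mul_smul, ← pow_add, mul_add, mul_one, add_comm]⟩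
  obtain ⟨y, rfl⟩ := hiter (d + 2) x hx
  have hbig : a ≤ B + K * (d + 2) := by
    have := Nat.lt_mul_div_succ (a - B) (show 0 < d + 2 by omega)
    rw [hK, mul_comm]
    omega
  exact ⟨p ^ (B + K * (d + 2) - a) • y, by
    rw [← mul_smul, ← mul_smul, ← pow_add, ← pow_add,
      show a + (B + K * (d + 2) - a) = B + K * (d + 2) by omega]⟩

end CommutingAction

/-! ### Induction on the number of fixed points -/

lemma IsCyclotomicPModule.flat_of_fixedIn_le {p u : ℕ} {M : Type*} [AddCommGroup M]
    [Module ℤ[X] M] (hp : p.Prime) (hM : IsCyclotomicPModule p u M) {a : ℕ}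
    (h : fixedIn (⊤ : Submodule ℤ[X] M) ≤ natMul (p ^ a) ⊤) :
    ∀ j ≤ a, ∀ x : M, p ^ j • x = 0 → ∃ y : M, x = p ^ (a - j) • y := by
  intro j hj x hx
  have h1 : x ∈ natMul (p ^ (a - j)) (⊤ : Submodule ℤ[X] M) := by
    refine hM.mem_of_fixedIn_le hp le_top (h := j) ?_ trivial hx
    intro y hy
    obtain ⟨z, -, rfl⟩ := mem_natMul.1 (h hy)
    refine mem_natMul.2 ⟨_, nsmul_mem_natMul _ (Submodule.mem_top (x := z)), ?_⟩
    rw [← mul_smul, ← pow_add, show j + (a - j) = a by omega]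
  obtain ⟨y, -, hy⟩ := mem_natMul.1 h1
  exact ⟨y, hy.symm⟩

/-- A bound for the class in terms of the number `p^d` of fixed points. -/
def classBound : ℕ → ℕ
  | 0 => 0
  | d + 1 => (d + 2) * (d + 3) + classBound d

/-- A bound for the exponent in terms of the number `p^d` of fixed points. -/
def exponentBound (p : ℕ) : ℕ → ℕ
  | 0 => 0
  | d + 1 => (p ^ (d + 1) * (d + 2) + p + 1) + exponentBound p d

theorem CommutingAction.pow_exponentBound_smul_eq_zero {p u : ℕ} (hp : p.Prime) (d : ℕ)
    {V M : Type*} [AddCommGroup V] [Module ℤ[X] V] [AddCommGroup M] [Module ℤ[X] M]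
    (ρ : CommutingAction V M) (hV : IsCyclotomicPModule p u V) (hM : IsCyclotomicPModule p u M)
    (hfix : Nat.card (fixedIn (⊤ : Submodule ℤ[X] M)) ≤ p ^ d) {x : M}
    (hx : x ∈ ρ.power (classBound d)) : p ^ exponentBound p d • x = 0 := by
  have hfin := hM.finite
  by_cases hbot : fixedIn (⊤ : Submodule ℤ[X] M) = ⊥
  · have h1 := hM.eq_bot_of_fixedIn_eq_bot hp hbot
    have hx0 : x = 0 := by
      have : x ∈ (⊤ : Submodule ℤ[X] M) := trivial
      rw [h1] at this
      simpa using this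
    rw [hx0, smul_zero]
  induction d generalizing M with
  | zero =>
    refine absurd ?_ hbot
    rw [← Submodule.subsingleton_iff_eq_bot]
    exact Finite.card_le_one_iff_subsingleton.1 (by simpa using hfix)
  | succ d ih =>
    obtain ⟨n, hn⟩ := hM.exists_pow
    -- The least such n is a + 1: p^a M still contains all fixed points, giving flatness, while
    -- p^(a+1) M misses one, so d drops.
    have hex : ∃ n, ¬ fixedIn (⊤ : Submodule ℤ[X] M) ≤ natMul (p ^ n) ⊤ := by
      refine ⟨n, fun h => hbot ((Submodule.eq_bot_iff _).2 fun y hy => ?_)⟩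
      obtain ⟨z, -, rfl⟩ := mem_natMul.1 (h hy)
      exact hn z
    classical
    have hspec := Nat.find_spec hex
    have hmin := fun m => Nat.find_min hex (m := m)
    set b := Nat.find hex
    obtain ⟨a, ha⟩ : ∃ a, b = a + 1 := by
      refine Nat.exists_eq_succ_of_ne_zero fun h0 => hspec ?_
      rw [h0]
      exact fun y _ => mem_natMul.2 ⟨y, trivial, by simp⟩
    rw [ha] at hspec
    have hle : fixedIn (⊤ : Submodule ℤ[X] M) ≤ natMul (p ^ a) ⊤ := not_not.1 (hmin a (by omega))
    have hflat := hM.flat_of_fixedIn_le hp hle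
    set N := natMul (p ^ (a + 1)) (⊤ : Submodule ℤ[X] M)
    have hN : ∀ v, ∀ x ∈ N, ρ.act v x ∈ N := by
      intro v x hx
      obtain ⟨y, -, rfl⟩ := mem_natMul.1 hx
      rw [map_nsmul]
      exact nsmul_mem_natMul _ trivial
    have hlt : fixedIn N < fixedIn (⊤ : Submodule ℤ[X] M) :=
      lt_of_le_of_ne (fixedIn_mono le_top) fun h => hspec (h ▸ inf_le_left)
    have hfixN : Nat.card (fixedIn (⊤ : Submodule ℤ[X] N)) ≤ p ^ d :=
      (hM.card_fixedIn_submodule N).trans (hM.card_le_of_lt hp hlt hfix)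
    set g := (d + 2) * (d + 3)
    set B := p ^ (d + 1) * (d + 2) + p
    have hmem : ∀ i, ∀ x ∈ ρ.power (g + i), ∃ y ∈ (ρ.restrict N hN).power i,
        (y : M) = p ^ (B + 1) • x := by
      intro i
      induction i with
      | zero =>
        intro x hx
        obtain ⟨y, hy⟩ := ρ.pow_smul_mem_of_flat hp hV hM hflat hfix hx
        -- The extra factor p moves p^B x from p^a M into p^(a+1) M.
        refine ⟨⟨p ^ (B + 1) • x, mem_natMul.2 ⟨y, trivial, ?_⟩⟩, trivial, rfl⟩
        rw [pow_succ', mul_smul, pow_succ', mul_smul]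
        exact congrArg (p • ·) hy.symm
      | succ i ihi =>
        intro x hx
        refine CommutingAction.image_induction (P := fun x =>
          ∃ y ∈ (ρ.restrict N hN).power (i + 1), (y : M) = p ^ (B + 1) • x) ?_
          ⟨0, zero_mem _, by simp⟩ ?_ ?_ hx
        · intro v x hx
          obtain ⟨y, hy, hxy⟩ := ihi x hx
          refine ⟨_, CommutingAction.act_mem_image v hy, ?_⟩
          rw [CommutingAction.coe_restrict_act, hxy, map_nsmul]
        · rintro x y ⟨a, ha, hxa⟩ ⟨b, hb, hyb⟩
          exact ⟨a + b, add_mem ha hb, by rw [Submodule.coe_add, hxa, hyb, smul_add]⟩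
        · rintro x ⟨a, ha, hxa⟩
          exact ⟨-a, neg_mem ha, by rw [Submodule.coe_neg, hxa, smul_neg]⟩
    obtain ⟨y, hy, hyx⟩ := hmem (classBound d) x hx
    have hy0 : p ^ exponentBound p d • y = 0 := by
      by_cases hbotN : fixedIn (⊤ : Submodule ℤ[X] N) = ⊥
      · have h1 := (hM.submodule N).eq_bot_of_fixedIn_eq_bot hp hbotN
        have hy0 : y = 0 := by
          have : y ∈ (⊤ : Submodule ℤ[X] N) := trivial
          rw [h1] at this
          simpa using this
        rw [hy0, smul_zero]
      · exact ih (ρ.restrict N hN) (hM.submodule N) hfixN hy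
          ((hM.submodule N).finite) hbotN
    have h2 : p ^ exponentBound p d • (y : M) = 0 := congrArg Subtype.val hy0
    rw [hyx, ← mul_smul, ← pow_add] at h2
    rw [exponentBound, add_comm]
    exact h2

/-! ### Metabelian Lie rings with an automorphism -/

section LieRing

variable {p u r : ℕ} {L : Type*} [LieRing L] [Module ℤ[X] L]

/-- A finite `p`-module on which `X ^ p^(u+1)` acts trivially and `X ^ p^u` has `p ^ r` fixed
points becomes cyclotomic after multiplication by `p ^ r`. -/
lemma isCyclotomicPModule_natMul {M : Type*} [AddCommGroup M] [Module ℤ[X] M] [Finite M]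
    (hp : p.Prime) (hM : ∃ n, ∀ x : M, p ^ n • x = 0)
    (hX : ∀ x : M, (X ^ p ^ (u + 1) : ℤ[X]) • x = x)
    (hr : Nat.card {x : M // (X ^ p ^ u : ℤ[X]) • x = x} = p ^ r) :
    IsCyclotomicPModule p u (natMul (p ^ r) (⊤ : Submodule ℤ[X] M)) where
  finite := inferInstance
  exists_pow := by
    obtain ⟨n, hn⟩ := hM
    exact ⟨n, fun x => Subtype.ext (hn x)⟩
  cyclotomic_smul := by
    have := Fact.mk hp
    rintro ⟨_, hx⟩
    obtain ⟨x, -, rfl⟩ := mem_natMul.1 hx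
    refine Subtype.ext ?_
    change cyclotomic (p ^ (u + 1)) ℤ • p ^ r • x = 0
    set F : AddSubgroup M := (Submodule.torsionBy ℤ[X] M (X ^ p ^ u - 1)).toAddSubgroup
    have hF : ∀ y, y ∈ F ↔ (X ^ p ^ u : ℤ[X]) • y = y := by
      intro y
      change (X ^ p ^ u - 1 : ℤ[X]) • y = 0 ↔ _
      rw [sub_smul, one_smul, sub_eq_zero]
    have hcard : Nat.card F = p ^ r := by
      rw [← hr]
      exact Nat.card_congr (Equiv.subtypeEquivRight hF)
    -- The cyclotomic polynomial acts as the trace of X^(p^u), whose values are fixed by X^(p^u); a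
    -- group of order p^r is killed by p^r.
    have hmem : cyclotomic (p ^ (u + 1)) ℤ • x ∈ F := by
      change (X ^ p ^ u - 1 : ℤ[X]) • cyclotomic (p ^ (u + 1)) ℤ • x = 0
      rw [← mul_smul, cyclotomic_prime_pow_eq_geom_sum hp, mul_geom_sum, ← pow_mul, ← pow_succ,
        sub_smul, hX, one_smul, sub_self]
    have h := card_nsmul_eq_zero' (x := (⟨_, hmem⟩ : F))
    rw [hcard] at h
    rw [smul_comm]
    exact congrArg Subtype.val h

/-- The elements of `p ^ r L` that centralize the derived ring. -/
noncomputable def derivedCentralizer (p r : ℕ)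
    (hX : ∀ x y : L, (X : ℤ[X]) • ⁅x, y⁆ = ⁅(X : ℤ[X]) • x, (X : ℤ[X]) • y⁆)
    (hsurj : ∀ x : L, ∃ y, (X : ℤ[X]) • y = x) : Submodule ℤ[X] L :=
  submoduleOfXStable
    { carrier := {z | z ∈ natMul (p ^ r) (⊤ : Submodule ℤ[X] L) ∧ ∀ x y : L, ⁅⁅x, y⁆, z⁆ = 0}
      add_mem' := fun ha hb => ⟨add_mem ha.1 hb.1, fun x y => by
        rw [lie_add, ha.2, hb.2, add_zero]⟩
      zero_mem' := ⟨zero_mem _, fun x y => lie_zero _⟩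
      neg_mem' := fun ha => ⟨neg_mem ha.1, fun x y => by rw [lie_neg, ha.2, neg_zero]⟩ }
    (by
      rintro z ⟨hz, hz'⟩
      refine ⟨Submodule.smul_mem _ _ hz, fun x y => ?_⟩
      obtain ⟨x, rfl⟩ := hsurj x
      obtain ⟨y, rfl⟩ := hsurj y
      rw [← hX, ← hX, hz', smul_zero])

lemma mem_derivedCentralizer
    {hX : ∀ x y : L, (X : ℤ[X]) • ⁅x, y⁆ = ⁅(X : ℤ[X]) • x, (X : ℤ[X]) • y⁆}
    {hsurj : ∀ x : L, ∃ y, (X : ℤ[X]) • y = x} {z : L} :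
    z ∈ derivedCentralizer p r hX hsurj ↔
      z ∈ natMul (p ^ r) (⊤ : Submodule ℤ[X] L) ∧ ∀ x y : L, ⁅⁅x, y⁆, z⁆ = 0 := Iff.rfl

lemma lie_mem_derivedCentralizer
    {hX : ∀ x y : L, (X : ℤ[X]) • ⁅x, y⁆ = ⁅(X : ℤ[X]) • x, (X : ℤ[X]) • y⁆}
    {hsurj : ∀ x : L, ∃ y, (X : ℤ[X]) • y = x} (w : L) {z : L}
    (hz : z ∈ derivedCentralizer p r hX hsurj) : ⁅w, z⁆ ∈ derivedCentralizer p r hX hsurj := by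
  obtain ⟨hz, hz'⟩ := mem_derivedCentralizer.1 hz
  refine mem_derivedCentralizer.2 ⟨?_, fun x y => ?_⟩
  · obtain ⟨z, -, rfl⟩ := mem_natMul.1 hz
    rw [lie_nsmul]
    exact nsmul_mem_natMul _ trivial
  · rw [leibniz_lie, hz', hz', lie_zero, add_zero]

/-- The adjoint action of `p ^ r L` on the centralizer of the derived ring. -/
noncomputable def adjointAction (p r : ℕ)
    (hX : ∀ x y : L, (X : ℤ[X]) • ⁅x, y⁆ = ⁅(X : ℤ[X]) • x, (X : ℤ[X]) • y⁆)
    (hsurj : ∀ x : L, ∃ y, (X : ℤ[X]) • y = x) :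
    CommutingAction (natMul (p ^ r) (⊤ : Submodule ℤ[X] L)) (derivedCentralizer p r hX hsurj) where
  act := AddMonoidHom.mk' (fun v => AddMonoidHom.mk'
    (fun z => ⟨⁅(v : L), (z : L)⁆, lie_mem_derivedCentralizer _ z.2⟩)
    fun x y => Subtype.ext (lie_add _ _ _)) fun v w => by ext x; exact add_lie _ _ _
  comm v w z := Subtype.ext (by
    change ⁅(v : L), ⁅(w : L), (z : L)⁆⁆ = ⁅(w : L), ⁅(v : L), (z : L)⁆⁆
    -- By Jacobi, the two operators differ by the action of [v, w], which is zero on the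
    -- centralizer.
    rw [leibniz_lie, (mem_derivedCentralizer.1 z.2).2, zero_add])
  equivariant v z := Subtype.ext (hX _ _)

lemma coe_adjointAction_act
    {hX : ∀ x y : L, (X : ℤ[X]) • ⁅x, y⁆ = ⁅(X : ℤ[X]) • x, (X : ℤ[X]) • y⁆}
    {hsurj : ∀ x : L, ∃ y, (X : ℤ[X]) • y = x} (v : natMul (p ^ r) (⊤ : Submodule ℤ[X] L))
    (z : derivedCentralizer p r hX hsurj) :
    ((adjointAction p r hX hsurj).act v z : L) = ⁅(v : L), (z : L)⁆ := rfl

lemma lowerCentralSeries_succ_induction {R : Type*} [LieRing R] {i : ℕ} {P : R → Prop}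
    (lie : ∀ a : R, ∀ b ∈ LieModule.lowerCentralSeries ℤ R R i, P ⁅a, b⁆) (zero : P 0)
    (add : ∀ x y, P x → P y → P (x + y)) (smul : ∀ (n : ℤ) (x), P x → P (n • x)) {x : R}
    (hx : x ∈ LieModule.lowerCentralSeries ℤ R R (i + 1)) : P x := by
  rw [LieModule.lowerCentralSeries_succ, ← LieSubmodule.mem_toSubmodule,
    LieSubmodule.lieIdeal_oper_eq_linear_span'] at hx
  induction hx using Submodule.span_induction with
  | mem x hx =>
    obtain ⟨a, -, b, hb, rfl⟩ := hx
    exact lie a b hb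
  | zero => exact zero
  | add x y _ _ hx hy => exact add x y hx hy
  | smul n x _ hx => exact smul n x hx

/-- If `J` lies in `p ^ (r + e) L`, then the lower central series of `J` is contained in
`p ^ e` times the powers of the adjoint action. -/
lemma exists_mem_power_of_mem_lowerCentralSeries {e : ℕ}
    (hmet : ∀ x y z w : L, ⁅⁅x, y⁆, ⁅z, w⁆⁆ = 0)
    (hX : ∀ x y : L, (X : ℤ[X]) • ⁅x, y⁆ = ⁅(X : ℤ[X]) • x, (X : ℤ[X]) • y⁆)
    (hsurj : ∀ x : L, ∃ y, (X : ℤ[X]) • y = x) (J : LieIdeal ℤ L)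
    (hJ : ∀ a ∈ J, ∃ c : L, a = p ^ e • p ^ r • c) (i : ℕ) :
    ∀ x ∈ LieModule.lowerCentralSeries ℤ J J (i + 1),
      ∃ y ∈ (adjointAction p r hX hsurj).power i, (x : L) = p ^ e • (y : L) := by
  have hclosed : ∀ i (x : J),
      (∀ a : J, ∀ b ∈ LieModule.lowerCentralSeries ℤ J J i,
        ∃ y ∈ (adjointAction p r hX hsurj).power i, ⁅(a : L), (b : L)⁆ = p ^ e • (y : L)) →
      x ∈ LieModule.lowerCentralSeries ℤ J J (i + 1) →
        ∃ y ∈ (adjointAction p r hX hsurj).power i, (x : L) = p ^ e • (y : L) := by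
    intro i x h hx
    refine lowerCentralSeries_succ_induction (R := J) (i := i)
      (P := fun x => ∃ y ∈ (adjointAction p r hX hsurj).power i, (x : L) = p ^ e • (y : L))
      (fun a b hb => h a b hb) ?_ ?_ ?_ hx
    · exact ⟨0, zero_mem _, by simp⟩
    · rintro x y ⟨a, ha, hxa⟩ ⟨b, hb, hyb⟩
      exact ⟨a + b, add_mem ha hb, by simp [hxa, hyb]⟩
    · rintro n x ⟨a, ha, hxa⟩
      exact ⟨n • a, zsmul_mem ha n, by simp [hxa, smul_comm n]⟩
  induction i with
  | zero =>
    intro x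
    refine hclosed 0 x fun a b _ => ?_
    obtain ⟨c, hc⟩ := hJ a a.2
    -- The first commutator enters the centralizer by metabelianity, and its left entry supplies the
    -- factor p^e once and for all.
    refine ⟨⟨⁅p ^ r • c, (b : L)⁆, mem_derivedCentralizer.2 ⟨?_, fun x y => hmet _ _ _ _⟩⟩,
      trivial, ?_⟩
    · rw [nsmul_lie]
      exact nsmul_mem_natMul _ trivial
    · rw [hc, nsmul_lie]
  | succ i ih =>
    intro x
    refine hclosed (i + 1) x fun a b hb => ?_
    obtain ⟨y, hy, hby⟩ := ih b hb
    obtain ⟨c, hc⟩ := hJ a a.2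
    have ha : (a : L) ∈ natMul (p ^ r) (⊤ : Submodule ℤ[X] L) :=
      mem_natMul.2 ⟨p ^ e • c, trivial, by rw [hc, smul_comm]⟩
    exact ⟨(adjointAction p r hX hsurj).act ⟨a, ha⟩ y, CommutingAction.act_mem_image _ hy, by
      rw [hby, lie_nsmul, coe_adjointAction_act]⟩

/-- The main estimate, for a Lie ring with an automorphism acting as the variable. -/
lemma lieGamma_mulIdeal_eq_bot (hp : p.Prime) {s : ℕ} [Finite L]
    (hL : ∃ n, ∀ x : L, p ^ n • x = 0)
    (hmet : ∀ x y z w : L, ⁅⁅x, y⁆, ⁅z, w⁆⁆ = 0)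
    (hX : ∀ x y : L, (X : ℤ[X]) • ⁅x, y⁆ = ⁅(X : ℤ[X]) • x, (X : ℤ[X]) • y⁆)
    (hXp : ∀ x : L, (X ^ p ^ (u + 1) : ℤ[X]) • x = x)
    (hs : Nat.card {x : L // (X : ℤ[X]) • x = x} = p ^ s)
    (hr : Nat.card {x : L // (X ^ p ^ u : ℤ[X]) • x = x} = p ^ r) :
    lieGamma (classBound s + 2) (mulIdeal (p ^ (r + exponentBound p s)) L) = ⊥ := by
  have hsurj : ∀ x : L, ∃ y, (X : ℤ[X]) • y = x := by
    intro x
    refine ⟨(X ^ (p ^ (u + 1) - 1) : ℤ[X]) • x, ?_⟩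
    rw [← mul_smul, ← pow_succ', Nat.sub_add_cancel (Nat.one_le_pow _ _ hp.pos), hXp]
  set V := natMul (p ^ r) (⊤ : Submodule ℤ[X] L)
  set C := derivedCentralizer p r hX hsurj
  set ρ := adjointAction p r hX hsurj
  have hV : IsCyclotomicPModule p u V := isCyclotomicPModule_natMul hp hL hXp hr
  have hC : IsCyclotomicPModule p u C :=
    { finite := inferInstance
      exists_pow := by
        obtain ⟨n, hn⟩ := hL
        exact ⟨n, fun x => Subtype.ext (hn x)⟩
      cyclotomic_smul := fun x => by
        have h : cyclotomic (p ^ (u + 1)) ℤ • (x : L) = 0 :=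
          congrArg (fun z : V => (z : L))
            (hV.cyclotomic_smul ⟨x, (mem_derivedCentralizer.1 x.2).1⟩)
        exact Subtype.ext h }
  have hfix : Nat.card (fixedIn (⊤ : Submodule ℤ[X] C)) ≤ p ^ s := by
    rw [← hs]
    refine Nat.card_le_card_of_injective (fun x => (⟨x.1.1, ?_⟩ : {x : L // (X : ℤ[X]) • x = x})) ?_
    · have h : (X - 1 : ℤ[X]) • (x.1 : L) = 0 := congrArg Subtype.val (mem_fixedIn.1 x.2).2
      rwa [sub_smul, one_smul, sub_eq_zero] at h
    · intro x y hxy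
      have h : (x.1.1 : L) = y.1.1 :=
        congrArg (fun z : {x : L // (X : ℤ[X]) • x = x} => (z : L)) hxy
      exact Subtype.ext (Subtype.ext h)
  set e := exponentBound p s
  have hlcs := exists_mem_power_of_mem_lowerCentralSeries (r := r) (e := e) hmet hX hsurj
    (mulIdeal (p ^ (r + e)) L) (by
      rintro _ ⟨c, rfl⟩
      exact ⟨c, by rw [add_comm r e, pow_add, mul_smul]⟩)
  rw [lieGamma, LieSubmodule.eq_bot_iff]
  intro x hx
  obtain ⟨y, hy, hxy⟩ := hlcs (classBound s) x hx
  have h := ρ.pow_exponentBound_smul_eq_zero hp s hV hC hfix hy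
  refine Subtype.ext ?_
  rw [hxy]
  exact congrArg Subtype.val h

end LieRing

end

theorem mainTheorem6 :
    ∃ (g : ℕ → ℕ) (f : ℕ → ℕ → ℕ → ℕ → ℕ),
      (∀ s : ℕ, 1 ≤ g s) ∧
      ∀ (p t s r : ℕ), p.Prime → 1 ≤ t →
        ∀ (L : Type*) [LieRing L], IsLiePRing p L →
          LieAlgebra.derivedSeries ℤ L 2 = ⊥ →
          ∀ φ : L ≃ₗ⁅ℤ⁆ L,
            orderOf (lieAutToAddAut φ) = p ^ t →
            numFixedPoints (lieAutToAddAut φ) = p ^ s →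
            numFixedPoints (lieAutToAddAut φ ^ p ^ (t - 1)) = p ^ r →
            lieGamma (g s) (mulIdeal (p ^ f p t s r) L) = ⊥ := by
  -- In the class, one unit is for indexing from 1 and one for the commutator that enters the
  -- centralizer. In the exponent, r makes the module cyclotomic.
  refine ⟨fun s => classBound s + 2, fun p _ s r => r + exponentBound p s, fun s => by simp, ?_⟩
  intro p t s r hp ht L _ hL hmet φ hφ hs hr
  obtain ⟨u, rfl⟩ : ∃ u, t = u + 1 := ⟨t - 1, by omega⟩
  have := hL.finite
  let σ := lieAutToAddAut φ
  let _ : Module (Polynomial ℤ) L :=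
    Module.compHom L (Polynomial.aeval (σ : L →ₗ[ℤ] L) : Polynomial ℤ →ₐ[ℤ] Module.End ℤ L).toRingHom
  have hXn : ∀ (n : ℕ) (x : L), (Polynomial.X ^ n : Polynomial ℤ) • x = (σ ^ n) x := by
    intro n x
    change Polynomial.aeval (σ : L →ₗ[ℤ] L) (Polynomial.X ^ n : Polynomial ℤ) x = _
    rw [map_pow, Polynomial.aeval_X]
    induction n generalizing x with
    | zero => rfl
    | succ n ih => rw [pow_succ, pow_succ, Module.End.mul_apply, ih]; rfl
  have hX1 : ∀ x : L, (Polynomial.X : Polynomial ℤ) • x = φ x := by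
    intro x
    have h := hXn 1 x
    rw [pow_one, pow_one] at h
    exact h
  refine lieGamma_mulIdeal_eq_bot (u := u) hp ?_ ?_ ?_ ?_ ?_ ?_
  · have := Fact.mk hp
    obtain ⟨n, hn⟩ := IsPGroup.iff_card.1 hL.isPGroup
    refine ⟨n, fun x => ?_⟩
    rw [← hn]
    exact card_nsmul_eq_zero' (G := L)
  · intro x y z w
    have h1 : ∀ a b : L, ⁅a, b⁆ ∈ LieAlgebra.derivedSeries ℤ L 1 := fun a b =>
      LieSubmodule.lie_mem_lie (LieSubmodule.mem_top a) (LieSubmodule.mem_top b)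
    have h2 : ⁅⁅x, y⁆, ⁅z, w⁆⁆ ∈ LieAlgebra.derivedSeries ℤ L 2 :=
      LieSubmodule.lie_mem_lie (h1 x y) (h1 z w)
    rw [hmet] at h2
    simpa using h2
  · intro x y
    simp only [hX1, LieEquiv.map_lie]
  · intro x
    rw [hXn, ← hφ, pow_orderOf_eq_one]
    rfl
  · simp only [hX1]
    exact hs
  · simp only [hXn]
    exact hr
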